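/- \textbf{Setting.} Bob's asymmetric passive BB84 receiver consists of a beam splitter that sends each photon to the $X$ arm with probability $s\in(0,1)$ and to the $Z$ arm with probability $1-s$, a polarizing beam splitter in each arm (separating $|0\rangle,|1\rangle$ in the $Z$ arm and $(|0\rangle\pm|1\rangle)/\sqrt2$ in the $X$ arm), and four memoryless threshold detectors with the same efficiency $\eta_{\mathrm D}\in(0,1]$ and the same dark-count probability $p_{\mathrm{dark}}\in[0,1]$: a detector that is reached by $m$ photons stays silent with probability $(1-p_{\mathrm{dark}})(1-\eta_{\mathrm D})^m$, independently of the other detectors. In $N$ rounds Bob receives $N$ pulses (each in the bosonic Fock space of two polarization modes) in an arbitrary joint state, possibly entangled over the rounds and with an arbitrary further system. In each round a virtual quantum non-demolition measurement determines whether the pulse has $0$, $1$ or ${>}1$ photons, and then the receiver is applied. Let $\tilde{\boldsymbol n}_{>1}$ be the number of rounds in which Bob receives more than one photon, and let $\boldsymbol n_{\mathrm{mc}}$ be the observed number of multi-click rounds, i.e. rounds in which two or more of the four detectors click. A number $\lambda\in(0,1]$ is called a lower bound on the multi-click probability if every single-round state of a pulse with more than one photon produces a multi-click with probability at least $\lambda$.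 For integers $0\le k\le N$ and reals $\epsilon,\lambda$ put $$V^{\mathrm{ex}}(k,\epsilon,\lambda):=\min\Bigl(\Bigl\{t\in\{k,\dots,N\}:\ \sum_{i=0}^{k}\binom ti\lambda^i(1-\lambda)^{t-i}\le\epsilon\Bigr\}\cup\{N+1\}\Bigr).$$ \textbf{Lemma (exact upper bound on the multi-photon contributions).} Let $$\lambda_{\min}:=\eta_{\mathrm D}^2\cdot 2s(1-s).$$ Then $\lambda_{\min}\in(0,1]$, and $\lambda_{\min}$ is a lower bound on the multi-click probability. For every $N$, every joint state of the $N$ pulses, and every $\epsilon_{\mathrm{PNE}}\ge 0$, $$\Pr\bigl[\tilde{\boldsymbol n}_{>1}\ \ge\ V^{\mathrm{ex}}(\boldsymbol n_{\mathrm{mc}},\epsilon_{\mathrm{PNE}},\lambda_{\min})\bigr]\ \le\ \epsilon_{\mathrm{PNE}},$$ and the same holds with $\lambda_{\min}$ replaced by any $\lambda\in(0,1]$ that is a lower bound on the multi-click probability. -/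

import Mathlib

open scoped ENNReal

noncomputable section

namespace PassiveBB84

/-- Parameters of the asymmetric passive receiver: the beam splitter sends a photon to the `X` arm
with probability `s` and to the `Z` arm with probability `1 - s`; all four threshold detectors have
efficiency `eta` and dark-count probability `pdark` per gate. -/
structure PassiveReceiver where
  s : ℝ
  eta : ℝ
  pdark : ℝ
  s_mem : s ∈ Set.Ioo (0 : ℝ) 1
  eta_mem : eta ∈ Set.Ioc (0 : ℝ) 1
  pdark_mem : pdark ∈ Set.Icc (0 : ℝ) 1

/-- The two arms of the passive receiver. -/
inductive Arm
  | X
  | Z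
  deriving DecidableEq

instance : Fintype Arm := ⟨{Arm.X, Arm.Z}, fun a => by cases a <;> decide⟩

/-- The four detectors: in each arm, one for each bit value. -/
abbrev Detector := Arm × Fin 2

/-- The outcome of the virtual photon-number measurement: `0`, `1` or `> 1` photons. -/
inductive QND
  | zero
  | one
  | many
  deriving DecidableEq

instance : Fintype QND := ⟨{QND.zero, QND.one, QND.many}, fun a => by cases a <;> decide⟩

/-- The photon-number class of an `n`-photon pulse. -/
def qndClass : ℕ → QND
  | 0 => .zero
  | 1 => .one
  | _ => .many

/-- A product basis vector `|f 0⟩ ⊗ ⋯ ⊗ |f (n-1)⟩` of the `n`-photon space over the single-photon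
basis `α`, for an arbitrary photon number `n`. -/
abbrev PhotonWord (α : Type) := Σ n : ℕ, (Fin n → α)

/-- A joint state of the `N` pulses that reach Bob and of a Hilbert space `H` which holds
everything else (Alice's registers, Eve's memory, a purifying system).

A pulse lives in the bosonic Fock space over the two polarization modes `0`, `1`, i.e. in the
Hilbert sum over `n` of the permutation-symmetric parts of `(ℂ²)^{⊗ n}`. The state is a unit vector
of (Fock space)`^{⊗ N} ⊗ H`, given by its `H`-valued coefficients in the product basis. It may be
entangled over rounds, and over different photon numbers. As `H` is arbitrary, this covers every
density operator of the `N` pulses, by purification. -/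
structure PulseTrainState (N : ℕ) (H : Type*) [NormedAddCommGroup H] [InnerProductSpace ℂ H] where
  coeff : (Fin N → PhotonWord (Fin 2)) → H
  norm_eq_one : ∑' w, ‖coeff w‖ₑ ^ 2 = 1
  bosonic : ∀ (w : Fin N → PhotonWord (Fin 2)) (r : Fin N) (π : Equiv.Perm (Fin (w r).1)),
    coeff (Function.update w r ⟨(w r).1, (w r).2 ∘ π⟩) = coeff w

/-- The (unnormalized) post-measurement vector when the virtual measurement of the photon-number
class has the outcomes `i r` in the rounds `r`: the projection onto the corresponding sectors. -/
def qndProject {N : ℕ} {H : Type*} [NormedAddCommGroup H] [InnerProductSpace ℂ H]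
    (i : Fin N → QND) (φ : (Fin N → PhotonWord (Fin 2)) → H) :
    (Fin N → PhotonWord (Fin 2)) → H :=
  fun w => if ∀ r, qndClass (w r).1 = i r then φ w else 0

/-- The single-photon amplitude from polarization mode `a` to the input of detector `j`. The beam
splitter has amplitude `√s` to the `X` arm and `√(1 - s)` to the `Z` arm; the polarizing beam
splitters separate `|0⟩, |1⟩` in the `Z` arm and `(|0⟩ ± |1⟩)/√2` in the `X` arm. -/
def PassiveReceiver.amplitude (B : PassiveReceiver) : Detector → Fin 2 → ℝ
  | (Arm.Z, y), a => if y = a then √(1 - B.s) else 0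
  | (Arm.X, y), a => √B.s * ((if y = 1 ∧ a = 1 then -1 else 1) / √2)

/-- The `H`-valued amplitude of the configuration `g` of photons at the detector inputs, after the
linear optics has acted on each photon: round `r` has `(g r).1` photons, and the photon `l` of this
round is in the input mode of detector `(g r).2 l`. -/
def PassiveReceiver.detectorAmp (B : PassiveReceiver) {N : ℕ} {H : Type*} [NormedAddCommGroup H]
    [InnerProductSpace ℂ H] (φ : (Fin N → PhotonWord (Fin 2)) → H)
    (g : Fin N → PhotonWord Detector) : H :=
  ∑ w : (r : Fin N) → (Fin (g r).1 → Fin 2),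
    ((∏ r, ∏ l, B.amplitude ((g r).2 l) (w r l) : ℝ) : ℂ) • φ (fun r => ⟨(g r).1, w r⟩)

/-- The number of photons at the input of detector `j`. -/
def photonsAt (g : PhotonWord Detector) (j : Detector) : ℕ :=
  (Finset.univ.filter (fun l => g.2 l = j)).card

/-- The probability that a threshold detector does not click on `m` photons: no dark count, and
each photon is missed. -/
def PassiveReceiver.noClick (B : PassiveReceiver) (m : ℕ) : ℝ :=
  (1 - B.pdark) * (1 - B.eta) ^ m

/-- The probability that exactly the detectors in `C` click, given the photons at the inputs. -/
def PassiveReceiver.response (B : PassiveReceiver) (g : PhotonWord Detector)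
    (C : Finset Detector) : ℝ :=
  (∏ j ∈ C, (1 - B.noClick (photonsAt g j))) * ∏ j ∈ Finset.univ \ C, B.noClick (photonsAt g j)

/-- The record of a run: for each round the outcome of the virtual photon-number measurement, and
the set of detectors that clicked. -/
abbrev Record (N : ℕ) := (Fin N → QND) × (Fin N → Finset Detector)

/-- The Born probability of a record. -/
def PassiveReceiver.born (B : PassiveReceiver) {N : ℕ} {H : Type*} [NormedAddCommGroup H]
    [InnerProductSpace ℂ H] (ψ : PulseTrainState N H) (x : Record N) : ℝ≥0∞ :=
  ∑' g : Fin N → PhotonWord Detector,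
    ENNReal.ofReal (∏ r, B.response (g r) (x.2 r)) *
      ‖B.detectorAmp (qndProject x.1 ψ.coeff) g‖ₑ ^ 2

lemma PassiveReceiver.noClick_nonneg (B : PassiveReceiver) (m : ℕ) : 0 ≤ B.noClick m :=
  mul_nonneg (by linarith [B.pdark_mem.2]) (pow_nonneg (by linarith [B.eta_mem.2]) _)

lemma PassiveReceiver.noClick_le_one (B : PassiveReceiver) (m : ℕ) : B.noClick m ≤ 1 :=
  mul_le_one₀ (by linarith [B.pdark_mem.1]) (pow_nonneg (by linarith [B.eta_mem.2]) _)
    (pow_le_one₀ (by linarith [B.eta_mem.2]) (by linarith [B.eta_mem.1]))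

lemma PassiveReceiver.response_nonneg (B : PassiveReceiver) (g : PhotonWord Detector)
    (C : Finset Detector) : 0 ≤ B.response g C :=
  mul_nonneg (Finset.prod_nonneg fun j _ => by linarith [B.noClick_le_one (photonsAt g j)])
    (Finset.prod_nonneg fun _ _ => B.noClick_nonneg _)

lemma PassiveReceiver.sum_response (B : PassiveReceiver) (g : PhotonWord Detector) :
    ∑ C, B.response g C = 1 := by
  have h := Finset.prod_add (fun j => 1 - B.noClick (photonsAt g j))
    (fun j => B.noClick (photonsAt g j)) (Finset.univ : Finset Detector)
  simp only [sub_add_cancel, Finset.prod_const_one, Finset.powerset_univ] at h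
  exact h.symm

lemma PassiveReceiver.sum_prod_response (B : PassiveReceiver) {N : ℕ}
    (g : Fin N → PhotonWord Detector) :
    ∑ C : Fin N → Finset Detector, ENNReal.ofReal (∏ r, B.response (g r) (C r)) = 1 := by
  rw [← ENNReal.ofReal_sum_of_nonneg
    (fun C _ => Finset.prod_nonneg fun r _ => B.response_nonneg _ _)]
  have h := Finset.prod_univ_sum (fun _ : Fin N => (Finset.univ : Finset (Finset Detector)))
    (fun r C => B.response (g r) C)
  simp only [B.sum_response, Finset.prod_const_one, Fintype.piFinset_univ] at h
  rw [← h, ENNReal.ofReal_one]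

/-- The linear optics is an isometry on one photon. -/
lemma PassiveReceiver.sum_amplitude (B : PassiveReceiver) (a b : Fin 2) :
    ∑ j, B.amplitude j a * B.amplitude j b = if a = b then 1 else 0 := by
  have h1 : √B.s * √B.s = B.s := Real.mul_self_sqrt B.s_mem.1.le
  have h2 : √(1 - B.s) * √(1 - B.s) = 1 - B.s := Real.mul_self_sqrt (by linarith [B.s_mem.2])
  have h3 : (√2 : ℝ) * √2 = 2 := Real.mul_self_sqrt (by norm_num)
  have h4 : (√2 : ℝ) ≠ 0 := by positivity
  have hA : (Finset.univ : Finset Arm) = {Arm.X, Arm.Z} := rfl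
  have key : ∀ c d : ℝ, (√B.s * (c / √2)) * (√B.s * (d / √2)) = B.s * (c * d) / 2 := by
    intro c d
    rw [mul_div_assoc', mul_div_assoc', div_mul_div_comm, h3]
    linear_combination (c * d / 2) * h1
  rw [Fintype.sum_prod_type, hA, Finset.sum_pair (by decide)]
  fin_cases a <;> fin_cases b <;>
    simp only [Fin.sum_univ_two, PassiveReceiver.amplitude, key] <;> simp [h2] <;> ring

lemma PassiveReceiver.sum_prod_amplitude (B : PassiveReceiver) {N : ℕ} (n : Fin N → ℕ)
    (w w' : (r : Fin N) → (Fin (n r) → Fin 2)) :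
    ∑ g : (r : Fin N) → (Fin (n r) → Detector),
      (∏ r, ∏ l, B.amplitude (g r l) (w r l)) * (∏ r, ∏ l, B.amplitude (g r l) (w' r l)) =
      if w = w' then 1 else 0 := by
  have h := Finset.prod_univ_sum
    (fun r : Fin N => (Finset.univ : Finset (Fin (n r) → Detector)))
    (fun r g => ∏ l, B.amplitude (g l) (w r l) * B.amplitude (g l) (w' r l))
  rw [Fintype.piFinset_univ] at h
  simp only [← Finset.prod_mul_distrib]
  rw [← h]
  have h2 : ∀ r, ∑ g : Fin (n r) → Detector,
      ∏ l, B.amplitude (g l) (w r l) * B.amplitude (g l) (w' r l) =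
      if w r = w' r then 1 else 0 := by
    intro r
    have h := Finset.prod_univ_sum
      (fun _ : Fin (n r) => (Finset.univ : Finset Detector))
      (fun l j => B.amplitude j (w r l) * B.amplitude j (w' r l))
    rw [Fintype.piFinset_univ] at h
    rw [← h]
    simp only [B.sum_amplitude, Finset.prod_ite_zero, Finset.prod_const_one]
    simp [funext_iff]
  simp only [h2, Finset.prod_ite_zero, Finset.prod_const_one]
  simp [funext_iff]

lemma enorm_sq_eq_ofReal {H : Type*} [NormedAddCommGroup H] (x : H) :
    ‖x‖ₑ ^ 2 = ENNReal.ofReal (‖x‖ ^ 2) := by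
  rw [ENNReal.ofReal_pow (norm_nonneg _), ofReal_norm]

/-- The linear optics is an isometry on each sector of fixed photon numbers. -/
lemma PassiveReceiver.sum_enorm_detectorAmp (B : PassiveReceiver) {N : ℕ} {H : Type*}
    [NormedAddCommGroup H] [InnerProductSpace ℂ H] (φ : (Fin N → PhotonWord (Fin 2)) → H)
    (n : Fin N → ℕ) :
    ∑ g : (r : Fin N) → (Fin (n r) → Detector), ‖B.detectorAmp φ (fun r => ⟨n r, g r⟩)‖ₑ ^ 2 =
      ∑ w : (r : Fin N) → (Fin (n r) → Fin 2), ‖φ (fun r => ⟨n r, w r⟩)‖ₑ ^ 2 := by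
  simp only [enorm_sq_eq_ofReal]
  rw [← ENNReal.ofReal_sum_of_nonneg (fun _ _ => by positivity),
    ← ENNReal.ofReal_sum_of_nonneg (fun _ _ => by positivity)]
  congr 1
  apply Complex.ofReal_injective
  push_cast
  have hsq : ∀ x : H, ((‖x‖ : ℂ)) ^ 2 = inner ℂ x x := fun x =>
    (inner_self_eq_norm_sq_to_K (𝕜 := ℂ) x).symm
  have hamp : ∀ g : (r : Fin N) → (Fin (n r) → Detector),
      B.detectorAmp φ (fun r => ⟨n r, g r⟩) = ∑ w : (r : Fin N) → (Fin (n r) → Fin 2),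
        ((∏ r, ∏ l, B.amplitude (g r l) (w r l) : ℝ) : ℂ) • φ (fun r => ⟨n r, w r⟩) :=
    fun _ => rfl
  simp only [hsq, hamp, sum_inner, inner_sum, inner_smul_left,
    inner_smul_right, Complex.conj_ofReal, Finset.mul_sum]
  rw [Finset.sum_comm]
  refine Finset.sum_congr rfl fun w _ => ?_
  rw [Finset.sum_comm]
  have : ∀ w' : (r : Fin N) → (Fin (n r) → Fin 2),
      ∑ g : (r : Fin N) → (Fin (n r) → Detector),
        ((∏ r, ∏ l, B.amplitude (g r l) (w' r l) : ℝ) : ℂ) *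
          (((∏ r, ∏ l, B.amplitude (g r l) (w r l) : ℝ) : ℂ) *
            inner ℂ (φ fun r => ⟨n r, w' r⟩) (φ fun r => ⟨n r, w r⟩)) =
        if w' = w then inner ℂ (φ fun r => ⟨n r, w' r⟩) (φ fun r => ⟨n r, w r⟩) else 0 := by
    intro w'
    have h := congrArg (fun t : ℝ => (t : ℂ)) (B.sum_prod_amplitude n w' w)
    simp only [Complex.ofReal_sum, Complex.ofReal_mul] at h
    simp only [← mul_assoc, ← Finset.sum_mul]
    rw [h]
    split_ifs <;> simp
  refine Eq.trans (Finset.sum_congr rfl fun w' _ => Eq.trans (Finset.sum_congr rfl fun g _ => ?_)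
    (this w')) (by simp)
  ring

/-- Photon-number strings together with words of these lengths. -/
def wordEquiv (N : ℕ) (α : Type) :
    (Σ n : Fin N → ℕ, (r : Fin N) → (Fin (n r) → α)) ≃ (Fin N → PhotonWord α) where
  toFun p := fun r => ⟨p.1 r, p.2 r⟩
  invFun w := ⟨fun r => (w r).1, fun r => (w r).2⟩
  left_inv _ := rfl
  right_inv _ := rfl

lemma PassiveReceiver.tsum_enorm_detectorAmp (B : PassiveReceiver) {N : ℕ} {H : Type*}
    [NormedAddCommGroup H] [InnerProductSpace ℂ H] (φ : (Fin N → PhotonWord (Fin 2)) → H) :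
    ∑' g, ‖B.detectorAmp φ g‖ₑ ^ 2 = ∑' w, ‖φ w‖ₑ ^ 2 := by
  rw [← (wordEquiv N Detector).tsum_eq, ← (wordEquiv N (Fin 2)).tsum_eq, ENNReal.tsum_sigma',
    ENNReal.tsum_sigma']
  refine tsum_congr fun n => ?_
  rw [tsum_fintype, tsum_fintype]
  exact B.sum_enorm_detectorAmp φ n

/-- The Born probabilities sum to one. -/
lemma PassiveReceiver.sum_born (B : PassiveReceiver) {N : ℕ} {H : Type*} [NormedAddCommGroup H]
    [InnerProductSpace ℂ H] (ψ : PulseTrainState N H) : ∑ x : Record N, B.born ψ x = 1 := by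
  rw [Fintype.sum_prod_type]
  have h1 : ∀ i : Fin N → QND, ∑ C, B.born ψ (i, C) =
      ∑' w, ‖qndProject i ψ.coeff w‖ₑ ^ 2 := by
    intro i
    rw [← B.tsum_enorm_detectorAmp]
    unfold PassiveReceiver.born
    rw [← Summable.tsum_finsetSum (fun _ _ => ENNReal.summable)]
    refine tsum_congr fun g => ?_
    change ∑ C : Fin N → Finset Detector, ENNReal.ofReal (∏ r, B.response (g r) (C r)) *
      ‖B.detectorAmp (qndProject i ψ.coeff) g‖ₑ ^ 2 = _
    rw [← Finset.sum_mul, B.sum_prod_response, one_mul]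
  simp only [h1]
  rw [← Summable.tsum_finsetSum (fun _ _ => ENNReal.summable), ← ψ.norm_eq_one]
  refine tsum_congr fun w => ?_
  rw [Finset.sum_eq_single (fun r => qndClass (w r).1)]
  · simp [qndProject]
  · intro i _ hi
    have : ¬ ∀ r, qndClass (w r).1 = i r := fun h => hi (funext fun r => (h r).symm)
    simp [qndProject, this]
  · simp

/-- The joint law of the virtual photon-number outcomes and of the click patterns in `N` rounds. -/
def PassiveReceiver.recordLaw (B : PassiveReceiver) {N : ℕ} {H : Type*} [NormedAddCommGroup H]
    [InnerProductSpace ℂ H] (ψ : PulseTrainState N H) : PMF (Record N) :=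
  PMF.ofFintype (B.born ψ) (B.sum_born ψ)

/-- The probability of an event about the record. -/
def PassiveReceiver.prob (B : PassiveReceiver) {N : ℕ} {H : Type*} [NormedAddCommGroup H]
    [InnerProductSpace ℂ H] (ψ : PulseTrainState N H) (E : Set (Record N)) : ℝ≥0∞ :=
  (B.recordLaw ψ).toOuterMeasure E

/-- The number of rounds in which Bob receives more than one photon. -/
def numMany {N : ℕ} (x : Record N) : ℕ := (Finset.univ.filter (fun r => x.1 r = QND.many)).card

/-- The observed number of multi-click rounds, in which two or more detectors click. -/
def numMultiClick {N : ℕ} (x : Record N) : ℕ :=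
  (Finset.univ.filter (fun r => 2 ≤ (x.2 r).card)).card

/-- `lam` is a lower bound on the multi-click probability of a single round, for every state of a
pulse with more than one photon. -/
def PassiveReceiver.IsMultiClickLowerBound (B : PassiveReceiver) (lam : ℝ) : Prop :=
  ∀ φ : PulseTrainState 1 ℂ, (∀ w, φ.coeff w ≠ 0 → 1 < (w 0).1) →
    ENNReal.ofReal lam ≤ B.prob φ {x | 2 ≤ (x.2 0).card}

/-- `λ_min = η_D² · 2 s (1 - s)`. -/
def PassiveReceiver.lambdaMin (B : PassiveReceiver) : ℝ := B.eta ^ 2 * (2 * B.s * (1 - B.s))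

/-- The distribution function `Pr[Bin(t, lam) ≤ k]` for `k ≤ t`. -/
def binomCDF (t : ℕ) (lam : ℝ) (k : ℕ) : ℝ :=
  ∑ i ∈ Finset.range (k + 1), (t.choose i : ℝ) * lam ^ i * (1 - lam) ^ (t - i)

/-- The exact inversion `V^ex(k, ε, lam)` of the binomial distribution function for `N` rounds. -/
def Vex (N k : ℕ) (ε lam : ℝ) : ℕ :=
  sInf ({t | k ≤ t ∧ t ≤ N ∧ binomCDF t lam k ≤ ε} ∪ {N + 1})

end PassiveBB84

end

noncomputable section

namespace PassiveBB84

/-! The proof fixes the photon-number outcomes, so that the number `t` of multi-photon rounds is a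
constant, and compares the multi-click count with a binomial variable.

For `λ_min`, single out two photons of a pulse with at least two. The optics acts on each photon
separately, and the part of it that leads into a given arm is a multiple of an isometry. Hence the
two photons reach different arms with probability exactly `2s(1-s)`, whatever their joint state
(`sum_arm_ne_arm`). Two detectors are then hit, and both click with probability at least `η²`
(`sq_eta_le_multiClick`).

A single-pulse bound `lam` survives entanglement. Expanding the further system in a Hilbert basis
turns a vector-valued pulse into a sum of scalar unnormalized ones. In round `r`, fix the photon
configuration of the other rounds at the detector inputs: what remains is such a vector-valued pulse
(`roundVector`). So `lam` bounds the multi-click probability of a multi-photon round given the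
clicks in all other rounds (`ofReal_mul_sum_born_le`).

Induction over the multi-photon rounds then gives binomial domination, Pr[count ≤ k] ≤ Pr[Bin(t,
lam) ≤ k] (`sum_count_le_binomCDF`). For fixed `t` the bad event lies in {count ≤ k} for the largest
bad count k. The binomial distribution function is at most `ε` there, because it is antitone in `t`
(`binomCDF_le_of_Vex_le`). Averaging over the photon-number outcomes finishes the proof. -/

/-! ### The binomial distribution function and its inversion. -/

lemma binomCDF_succ_zero (t : ℕ) (lam : ℝ) :
    binomCDF (t + 1) lam 0 = (1 - lam) * binomCDF t lam 0 := by
  simp [binomCDF, pow_succ, mul_comm]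

/-- Pascal's rule, i.e. conditioning on one of the trials. This recursion drives both the
antitonicity in `t` and the domination argument. -/
lemma binomCDF_succ_succ (t : ℕ) (lam : ℝ) (k : ℕ) :
    binomCDF (t + 1) lam (k + 1) =
      lam * binomCDF t lam k + (1 - lam) * binomCDF t lam (k + 1) := by
  have key : ∀ i, ((t + 1).choose (i + 1) : ℝ) * lam ^ (i + 1) * (1 - lam) ^ (t + 1 - (i + 1)) =
      lam * ((t.choose i : ℝ) * lam ^ i * (1 - lam) ^ (t - i)) +
      (1 - lam) * ((t.choose (i + 1) : ℝ) * lam ^ (i + 1) * (1 - lam) ^ (t - (i + 1))) := by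
    intro i
    rw [Nat.choose_succ_succ, Nat.add_sub_add_right]
    rcases lt_or_ge i t with h | h
    · obtain ⟨d, rfl⟩ : ∃ d, t = i + 1 + d := ⟨t - (i + 1), by omega⟩
      have h1 : i + 1 + d - i = d + 1 := by omega
      have h2 : i + 1 + d - (i + 1) = d := by omega
      rw [h1, h2]; push_cast; ring
    -- Here `t - (i + 1)` is truncated, but its binomial coefficient vanishes.
    · rw [Nat.choose_eq_zero_of_lt (show t < i + 1 by omega)]
      push_cast; ring
  unfold binomCDF
  rw [Finset.sum_range_succ', Finset.sum_congr rfl fun i _ => key i, Finset.sum_add_distrib,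
    ← Finset.mul_sum, ← Finset.mul_sum,
    Finset.sum_range_succ' (fun i => (t.choose i : ℝ) * lam ^ i * (1 - lam) ^ (t - i)) (k + 1)]
  simp only [Nat.choose_zero_right, pow_zero, Nat.sub_zero, Nat.cast_one, mul_one, pow_succ]
  ring

lemma binomCDF_mono_right {lam : ℝ} (h0 : 0 ≤ lam) (h1 : lam ≤ 1) (t : ℕ) :
    Monotone (binomCDF t lam) := by
  refine monotone_nat_of_le_succ fun k => ?_
  unfold binomCDF
  rw [Finset.sum_range_succ _ (k + 1)]
  have : 0 ≤ 1 - lam := by linarith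
  exact le_add_of_nonneg_right (by positivity)

lemma binomCDF_nonneg {lam : ℝ} (h0 : 0 ≤ lam) (h1 : lam ≤ 1) (t k : ℕ) :
    0 ≤ binomCDF t lam k := by
  have : 0 ≤ 1 - lam := by linarith
  exact Finset.sum_nonneg fun i _ => by positivity

/-- One more trial replaces the value at `k` by an average of it with the smaller value at `k - 1`
(with 0 if `k = 0`). -/
lemma binomCDF_antitone_left {lam : ℝ} (h0 : 0 ≤ lam) (h1 : lam ≤ 1) (k : ℕ) :
    Antitone fun t => binomCDF t lam k := by
  refine antitone_nat_of_succ_le fun t => ?_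
  cases k with
  | zero =>
    rw [binomCDF_succ_zero]
    nlinarith [binomCDF_nonneg h0 h1 t 0]
  | succ k =>
    rw [binomCDF_succ_succ]
    nlinarith [binomCDF_mono_right h0 h1 t (Nat.le_succ k)]

/-- If `Vex N k ε lam ≤ t ≤ N`, then the binomial distribution function for `t` trials is at most
`ε` at `k`. -/
lemma binomCDF_le_of_Vex_le {N k t : ℕ} {ε lam : ℝ} (h0 : 0 ≤ lam) (h1 : lam ≤ 1) (ht : t ≤ N)
    (h : Vex N k ε lam ≤ t) : binomCDF t lam k ≤ ε := by
  have hmem : Vex N k ε lam ∈ ({t | k ≤ t ∧ t ≤ N ∧ binomCDF t lam k ≤ ε} ∪ {N + 1} : Set ℕ) :=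
    Nat.sInf_mem ⟨N + 1, Or.inr rfl⟩
  rcases hmem with hm | hm
  · exact (binomCDF_antitone_left h0 h1 k h).trans hm.2.2
  -- The default value `N + 1` cannot be at most `t ≤ N`.
  · rw [Set.mem_singleton_iff] at hm
    omega

/-- Makes the set of bad counts for a given `t` finite, so that it has a maximum. -/
lemma le_of_Vex_le {N k t : ℕ} {ε lam : ℝ} (ht : t ≤ N)
    (h : Vex N k ε lam ≤ t) : k ≤ t := by
  have hmem : Vex N k ε lam ∈ ({t | k ≤ t ∧ t ≤ N ∧ binomCDF t lam k ≤ ε} ∪ {N + 1} : Set ℕ) :=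
    Nat.sInf_mem ⟨N + 1, Or.inr rfl⟩
  rcases hmem with hm | hm
  · exact hm.1.trans h
  · rw [Set.mem_singleton_iff] at hm
    omega

/-! ### Binomial domination from conditional lower bounds. -/

section Domination

variable {ι α : Type*} [Fintype ι] [DecidableEq ι] [Fintype α]

/-- `T` holds one representative of each line in direction `r`. It does not depend on `F`, so two
sums can be compared line by line. -/
lemma sum_eq_sum_sum_update [Nonempty α] {M : Type*} [AddCommMonoid M] (r : ι) :
    ∃ (T : Finset (ι → α)), ∀ F : (ι → α) → M,
      ∑ C, F C = ∑ C ∈ T, ∑ c, F (Function.update C r c) := by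
  classical
  obtain ⟨c₀⟩ := ‹Nonempty α›
  let e := Equiv.funSplitAt r α
  refine ⟨(Finset.univ : Finset ({j // j ≠ r} → α)).map
    ⟨fun y => e.symm (c₀, y), fun y y' h => by simpa using h⟩, fun F => ?_⟩
  rw [Finset.sum_map, ← e.symm.sum_comp, Fintype.sum_prod_type, Finset.sum_comm]
  refine Finset.sum_congr rfl fun y _ => Finset.sum_congr rfl fun c _ => congrArg F ?_
  funext j
  by_cases h : j = r
  · subst h; simp [e]
  · rw [Function.update_of_ne h]
    change e.symm (c, y) j = e.symm (c₀, y) j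
    simp [e, h]

/-- A lower bound on the conditional probability of `P` at `r` given all other coordinates gives
the same bound given an event which does not depend on the coordinate `r`. -/
lemma sum_ite_and_not_le [Nonempty α] (q : (ι → α) → ℝ) (P : α → Prop) [DecidablePred P]
    (lam : ℝ) (r : ι)
    (hq : ∀ C, lam * ∑ c, q (Function.update C r c) ≤
      ∑ c, if P c then q (Function.update C r c) else 0)
    (E : (ι → α) → Prop) [DecidablePred E] (hE : ∀ C c, E (Function.update C r c) ↔ E C) :
    (∑ C, if E C ∧ ¬ P (C r) then q C else 0) ≤ (1 - lam) * ∑ C, if E C then q C else 0 := by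
  obtain ⟨T, hT⟩ := sum_eq_sum_sum_update (α := α) (M := ℝ) r
  rw [hT, hT, Finset.mul_sum]
  refine Finset.sum_le_sum fun C _ => ?_
  simp only [hE, Function.update_self]
  by_cases h : E C
  · simp only [h, true_and, if_true]
    have : ∑ c, q (Function.update C r c) = (∑ c, if P c then q (Function.update C r c) else 0) +
        ∑ c, if ¬ P c then q (Function.update C r c) else 0 := by
      rw [← Finset.sum_add_distrib]
      exact Finset.sum_congr rfl fun c _ => by by_cases h : P c <;> simp [h]
    linarith [hq C]
  · simp [h]

/-- If at each coordinate in `S` the conditional probability of `P` given all other coordinates is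
at least `lam`, then the number of coordinates in `S` with `P` stochastically dominates the binomial
law with parameters `S.card` and `lam`. -/
lemma sum_count_le_binomCDF [Nonempty α] (q : (ι → α) → ℝ) (P : α → Prop)
    [DecidablePred P] {lam : ℝ} (h0 : 0 ≤ lam) (h1 : lam ≤ 1) (S : Finset ι)
    (hq : ∀ r ∈ S, ∀ C, lam * ∑ c, q (Function.update C r c) ≤
      ∑ c, if P c then q (Function.update C r c) else 0) (k : ℕ) :
    (∑ C, if (S.filter fun r => P (C r)).card ≤ k then q C else 0) ≤
      binomCDF S.card lam k * ∑ C, q C := by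
  induction S using Finset.induction_on generalizing k with
  | empty =>
    have : binomCDF 0 lam k = 1 := by
      unfold binomCDF
      rw [Finset.sum_eq_single 0] <;> simp +contextual [Nat.choose_eq_zero_of_lt, Nat.pos_iff_ne_zero]
    simp [this]
  | insert r S hr ih =>
    have ih := ih fun r' hr' => hq r' (Finset.mem_insert_of_mem hr')
    -- As `r ∉ S`, the count over `S` does not see the coordinate `r`, as `sum_ite_and_not_le`
    -- requires.
    have hinv : ∀ C c, (S.filter fun r' => P (Function.update C r c r')) =
        S.filter fun r' => P (C r') := fun C c =>
      Finset.filter_congr fun j hj => by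
        rw [Function.update_of_ne (fun h : j = r => hr (h ▸ hj))]
    have hcount : ∀ C : ι → α, ((insert r S).filter fun r' => P (C r')).card =
        (S.filter fun r' => P (C r')).card + if P (C r) then 1 else 0 := by
      intro C
      rw [Finset.filter_insert]
      split_ifs
      · rw [Finset.card_insert_of_notMem (by simp [hr])]
      · simp
    rw [Finset.card_insert_of_notMem hr]
    have hr' := hq r (Finset.mem_insert_self r S)
    cases k with
    | zero =>
      rw [binomCDF_succ_zero]
      have h := sum_ite_and_not_le q P lam r hr'
        (fun C => (S.filter fun r' => P (C r')).card ≤ 0) (fun C c => by simp only [hinv])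
      have e : (∑ C, if ((insert r S).filter fun r' => P (C r')).card ≤ 0 then q C else 0) =
          ∑ C, if (S.filter fun r' => P (C r')).card ≤ 0 ∧ ¬ P (C r) then q C else 0 := by
        refine Finset.sum_congr rfl fun C _ => ?_
        rw [hcount]
        by_cases h : P (C r) <;> simp [h]
      rw [e]
      nlinarith [ih 0]
    | succ k =>
      rw [binomCDF_succ_succ]
      have h := sum_ite_and_not_le q P lam r hr'
        (fun C => (S.filter fun r' => P (C r')).card = k + 1) (fun C c => by simp only [hinv])
      -- At most `k + 1` successes on `insert r S` means at most `k` on `S`, or exactly `k + 1` on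
      -- `S` and a failure at `r`. Only the second event uses the bound at `r`; with `e2` the total
      -- is at most `lam` Pr[≤ k] + (1 - `lam`) Pr[≤ k + 1], and the induction hypothesis applies at
      -- both `k` and `k + 1`.
      have e : (∑ C, if ((insert r S).filter fun r' => P (C r')).card ≤ k + 1 then q C else 0) =
          (∑ C, if (S.filter fun r' => P (C r')).card ≤ k then q C else 0) +
          ∑ C, if (S.filter fun r' => P (C r')).card = k + 1 ∧ ¬ P (C r) then q C else 0 := by
        rw [← Finset.sum_add_distrib]
        refine Finset.sum_congr rfl fun C _ => ?_
        rw [hcount]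
        rcases lt_trichotomy (S.filter fun r' => P (C r')).card (k + 1) with h' | h' | h'
        · have : (S.filter fun r' => P (C r')).card ≤ k := by omega
          by_cases h : P (C r) <;> simp [h, this, h'.ne, h'.le]
        · by_cases h : P (C r) <;> simp [h, h']
        · have : ¬ (S.filter fun r' => P (C r')).card ≤ k := by omega
          by_cases h : P (C r) <;> simp [h, this, h'.ne', h'.not_ge]
      have e2 : (∑ C, if (S.filter fun r' => P (C r')).card ≤ k + 1 then q C else 0) =
          (∑ C, if (S.filter fun r' => P (C r')).card ≤ k then q C else 0) +
          ∑ C, if (S.filter fun r' => P (C r')).card = k + 1 then q C else 0 := by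
        rw [← Finset.sum_add_distrib]
        refine Finset.sum_congr rfl fun C _ => ?_
        rcases lt_trichotomy (S.filter fun r' => P (C r')).card (k + 1) with h' | h' | h'
        · have : (S.filter fun r' => P (C r')).card ≤ k := by omega
          simp [this, h'.ne, h'.le]
        · simp [h']
        · have : ¬ (S.filter fun r' => P (C r')).card ≤ k := by omega
          simp [this, h'.ne', h'.not_ge]
      have i1 := mul_le_mul_of_nonneg_left (ih k) h0
      have i2 := mul_le_mul_of_nonneg_left (ih (k + 1)) (sub_nonneg.2 h1)
      rw [e2] at i2
      rw [e]
      linarith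

end Domination

/-! ### A single pulse and its multi-click probability. -/

variable {H : Type*} [NormedAddCommGroup H] [InnerProductSpace ℂ H]

/-- The amplitude of the configuration `x` of the photons of a single pulse at the detector
inputs. -/
def PassiveReceiver.wordAmp (B : PassiveReceiver) (χ : PhotonWord (Fin 2) → H)
    (x : PhotonWord Detector) : H :=
  ∑ w : Fin x.1 → Fin 2, ((∏ l, B.amplitude (x.2 l) (w l) : ℝ) : ℂ) • χ ⟨x.1, w⟩

/-- The probability of a multi-click, given the photons at the detector inputs. -/
def PassiveReceiver.multiClick (B : PassiveReceiver) (x : PhotonWord Detector) : ℝ :=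
  ∑ C : Finset Detector, if 2 ≤ C.card then B.response x C else 0

lemma PassiveReceiver.multiClick_nonneg (B : PassiveReceiver) (x : PhotonWord Detector) :
    0 ≤ B.multiClick x :=
  Finset.sum_nonneg fun C _ => by
    split_ifs
    exacts [B.response_nonneg x C, le_rfl]

lemma PassiveReceiver.detectorAmp_const (B : PassiveReceiver)
    (φ : (Fin 1 → PhotonWord (Fin 2)) → H) (x : PhotonWord Detector) :
    B.detectorAmp φ (fun _ => x) = B.wordAmp (fun u => φ fun _ => u) x := by
  unfold PassiveReceiver.detectorAmp PassiveReceiver.wordAmp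
  rw [← (Equiv.funUnique (Fin 1) (Fin x.1 → Fin 2)).symm.sum_comp]
  refine Finset.sum_congr rfl fun w _ => ?_
  simp only [Fin.prod_univ_one]
  rfl

lemma PassiveReceiver.tsum_enorm_wordAmp (B : PassiveReceiver) (χ : PhotonWord (Fin 2) → H) :
    ∑' x, ‖B.wordAmp χ x‖ₑ ^ 2 = ∑' u, ‖χ u‖ₑ ^ 2 := by
  have h := B.tsum_enorm_detectorAmp (N := 1) fun w => χ (w 0)
  rw [← (Equiv.funUnique (Fin 1) (PhotonWord Detector)).symm.tsum_eq,
    ← (Equiv.funUnique (Fin 1) (PhotonWord (Fin 2))).symm.tsum_eq] at h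
  exact Eq.trans (tsum_congr fun x => by
    rw [← B.detectorAmp_const fun w => χ (w 0)]; rfl) h

lemma PassiveReceiver.prob_eq_sum (B : PassiveReceiver) {N : ℕ} (ψ : PulseTrainState N H)
    (E : Set (Record N)) [DecidablePred (· ∈ E)] :
    B.prob ψ E = ∑ i, ∑ C, if (i, C) ∈ E then B.born ψ (i, C) else 0 := by
  unfold PassiveReceiver.prob
  rw [PMF.toOuterMeasure_apply_fintype, Fintype.sum_prod_type]
  refine Finset.sum_congr rfl fun i _ => Finset.sum_congr rfl fun C _ => ?_
  rw [Set.indicator_apply]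
  rfl

lemma PassiveReceiver.ofReal_multiClick (B : PassiveReceiver) (x : PhotonWord Detector) :
    ENNReal.ofReal (B.multiClick x) =
      ∑ C : Finset Detector, if 2 ≤ C.card then ENNReal.ofReal (B.response x C) else 0 := by
  unfold PassiveReceiver.multiClick
  rw [ENNReal.ofReal_sum_of_nonneg]
  · exact Finset.sum_congr rfl fun C _ => by split_ifs <;> simp
  · intro C _
    split_ifs
    exacts [B.response_nonneg x C, le_rfl]

/-- The multi-click probability of a single pulse with more than one photon. -/
lemma PassiveReceiver.prob_multiClick (B : PassiveReceiver) (φ : PulseTrainState 1 H)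
    (hφ : ∀ w, φ.coeff w ≠ 0 → 1 < (w 0).1) :
    B.prob φ {x | 2 ≤ (x.2 0).card} = ∑' x, ENNReal.ofReal (B.multiClick x) *
      ‖B.wordAmp (fun u => φ.coeff fun _ => u) x‖ₑ ^ 2 := by
  have hclass : ∀ n, 1 < n → qndClass n = QND.many := by
    intro n hn
    obtain ⟨m, rfl⟩ : ∃ m, n = m + 2 := ⟨n - 2, by omega⟩
    rfl
  have hmany : qndProject (fun _ => QND.many) φ.coeff = φ.coeff := by
    funext w
    unfold qndProject
    by_cases h : φ.coeff w = 0
    · simp [h]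
    · rw [if_pos fun r => ?_]
      rw [Subsingleton.elim r 0]
      exact hclass _ (hφ w h)
  have hother : ∀ i : Fin 1 → QND, i ≠ (fun _ => QND.many) → ∀ C, B.born φ (i, C) = 0 := by
    intro i hi C
    have : qndProject i φ.coeff = 0 := by
      funext w
      unfold qndProject
      split_ifs with hw
      · by_contra h
        refine hi (funext fun r => ?_)
        rw [← hw r, Subsingleton.elim r 0]
        exact hclass _ (hφ w h)
      · rfl
    simp [PassiveReceiver.born, this, PassiveReceiver.detectorAmp]
  classical
  rw [B.prob_eq_sum, Finset.sum_eq_single (fun _ => QND.many)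
    (fun i _ hi => by simp [hother i hi]) (by simp)]
  rw [← (Equiv.funUnique (Fin 1) (Finset Detector)).symm.sum_comp]
  have hborn : ∀ C : Finset Detector, B.born φ (fun _ => QND.many, fun _ => C) =
      ∑' x, ENNReal.ofReal (B.response x C) *
        ‖B.wordAmp (fun u => φ.coeff fun _ => u) x‖ₑ ^ 2 := by
    intro C
    unfold PassiveReceiver.born
    rw [← (Equiv.funUnique (Fin 1) (PhotonWord Detector)).symm.tsum_eq]
    refine tsum_congr fun x => ?_
    rw [← B.detectorAmp_const, hmany, Fin.prod_univ_one]
    rfl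
  have hterm : ∀ C : Finset Detector,
      (if ((fun _ => QND.many, (Equiv.funUnique (Fin 1) (Finset Detector)).symm C) : Record 1) ∈
        {x : Record 1 | 2 ≤ (x.2 0).card} then
        B.born φ (fun _ => QND.many, (Equiv.funUnique (Fin 1) (Finset Detector)).symm C) else 0) =
      ∑' x, (if 2 ≤ C.card then ENNReal.ofReal (B.response x C) else 0) *
        ‖B.wordAmp (fun u => φ.coeff fun _ => u) x‖ₑ ^ 2 := by
    intro C
    change (if 2 ≤ C.card then B.born φ (fun _ => QND.many, fun _ => C) else 0) = _
    rw [hborn]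
    split_ifs <;> simp
  rw [Finset.sum_congr rfl fun C _ => hterm C,
    ← Summable.tsum_finsetSum (fun _ _ => ENNReal.summable)]
  refine tsum_congr fun x => ?_
  rw [← Finset.sum_mul, B.ofReal_multiClick]

/-! ### The bound `λ_min`. -/

lemma PassiveReceiver.le_one_sub_noClick (B : PassiveReceiver) {m : ℕ} (hm : m ≠ 0) :
    B.eta ≤ 1 - B.noClick m := by
  have h1 : (1 - B.eta) ^ m ≤ 1 - B.eta :=
    pow_le_of_le_one (by linarith [B.eta_mem.2]) (by linarith [B.eta_mem.1]) hm
  have h2 : 0 ≤ (1 - B.eta) ^ m := pow_nonneg (by linarith [B.eta_mem.2]) _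
  unfold PassiveReceiver.noClick
  nlinarith [B.pdark_mem.1]

/-- Two photons at different detectors cause a multi-click with probability at least `η²`. -/
lemma PassiveReceiver.sq_eta_le_multiClick (B : PassiveReceiver) (x : PhotonWord Detector)
    {l₀ l₁ : Fin x.1} (h : x.2 l₀ ≠ x.2 l₁) : B.eta ^ 2 ≤ B.multiClick x := by
  have hph : ∀ l, photonsAt x (x.2 l) ≠ 0 := fun l =>
    Finset.card_ne_zero_of_mem (a := l) (by simp)
  set p : Detector → ℝ := fun j => 1 - B.noClick (photonsAt x j) with hp
  -- Silence is given weight 0 at the two hit detectors. Expanding the product of `p j + q j` over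
  -- click sets then keeps only sets containing both, and `p j + q j = 1` elsewhere: this is the
  -- probability that these two click.
  set q : Detector → ℝ := fun j =>
    if j = x.2 l₀ ∨ j = x.2 l₁ then 0 else B.noClick (photonsAt x j) with hq
  have hprod : ∏ j, (p j + q j) = p (x.2 l₀) * p (x.2 l₁) := by
    rw [← Finset.prod_pair (f := p) h, ← Finset.prod_subset (Finset.subset_univ {x.2 l₀, x.2 l₁})]
    · refine Finset.prod_congr rfl fun j hj => ?_
      simp only [Finset.mem_insert, Finset.mem_singleton] at hj
      simp [hq, hj]
    · intro j _ hj
      simp only [Finset.mem_insert, Finset.mem_singleton] at hj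
      simp [hp, hq, hj]
  have hle : p (x.2 l₀) * p (x.2 l₁) ≤ B.multiClick x := by
    rw [← hprod, Finset.prod_add, Finset.powerset_univ]
    refine Finset.sum_le_sum fun C _ => ?_
    by_cases hC : x.2 l₀ ∈ C ∧ x.2 l₁ ∈ C
    · have h2 : 2 ≤ C.card := by
        rw [← Finset.card_pair h]
        exact Finset.card_le_card (by simp [Finset.insert_subset_iff, hC])
      rw [if_pos h2]
      refine mul_le_mul_of_nonneg_left (Finset.prod_le_prod (fun j _ => ?_) fun j _ => ?_)
        (Finset.prod_nonneg fun j _ => sub_nonneg.2 (B.noClick_le_one _))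
      all_goals
        simp only [hq]
        split_ifs
        all_goals first | exact le_rfl | exact B.noClick_nonneg _
    · have h0 : ∏ j ∈ Finset.univ \ C, q j = 0 := by
        rw [not_and_or] at hC
        rcases hC with hC | hC
        · exact Finset.prod_eq_zero (i := x.2 l₀) (by simp [hC]) (by simp [hq])
        · exact Finset.prod_eq_zero (i := x.2 l₁) (by simp [hC]) (by simp [hq])
      rw [h0, mul_zero]
      split_ifs
      exacts [B.response_nonneg x C, le_rfl]
  refine le_trans ?_ hle
  rw [sq]
  exact mul_le_mul (B.le_one_sub_noClick (hph _)) (B.le_one_sub_noClick (hph _))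
    B.eta_mem.1.le (sub_nonneg.2 (B.noClick_le_one _))

/-- The probability with which the beam splitter sends a photon to an arm. -/
def PassiveReceiver.armProb (B : PassiveReceiver) : Arm → ℝ
  | Arm.X => B.s
  | Arm.Z => 1 - B.s

/-- Within each arm, the linear optics is a multiple of an isometry on one photon. -/
lemma PassiveReceiver.sum_amplitude_arm (B : PassiveReceiver) (c : Arm) (a b : Fin 2) :
    ∑ j : Detector, (if j.1 = c then 1 else 0) * (B.amplitude j a * B.amplitude j b) =
      B.armProb c * if a = b then 1 else 0 := by
  have hZ : ∑ j : Detector, (if j.1 = Arm.Z then 1 else 0) * (B.amplitude j a * B.amplitude j b) =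
      B.armProb Arm.Z * if a = b then 1 else 0 := by
    have h2 : √(1 - B.s) * √(1 - B.s) = 1 - B.s := Real.mul_self_sqrt (by linarith [B.s_mem.2])
    have hA : (Finset.univ : Finset Arm) = {Arm.X, Arm.Z} := rfl
    rw [Fintype.sum_prod_type, hA, Finset.sum_pair (by decide)]
    fin_cases a <;> fin_cases b <;>
      simp [PassiveReceiver.amplitude, h2, PassiveReceiver.armProb]
  cases c with
  | Z => exact hZ
  | X =>
    -- The two arms together form an isometry, so the `X` arm is the complement of the `Z` arm.
    have h : ∀ j : Detector, (if j.1 = Arm.X then (1 : ℝ) else 0) =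
        1 - if j.1 = Arm.Z then 1 else 0 := by
      rintro ⟨c, y⟩
      cases c <;> simp
    simp only [h, sub_mul, one_mul, Finset.sum_sub_distrib, hZ, B.sum_amplitude,
      PassiveReceiver.armProb]
    ring

/-- The hypothesis says that the matrix `Kᵀ diag(v) K` is `c` times the identity; the conclusion is
its quadratic form on vectors with entries in `H`. -/
lemma sum_mul_norm_sq_eq {G W : Type*} [Fintype G] [Fintype W] [DecidableEq W] (v : G → ℝ)
    (K : G → W → ℝ) (c : ℝ)
    (h : ∀ w w', ∑ g, v g * (K g w * K g w') = c * if w = w' then 1 else 0) (χ : W → H) :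
    ∑ g, v g * ‖∑ w, (K g w : ℂ) • χ w‖ ^ 2 = c * ∑ w, ‖χ w‖ ^ 2 := by
  apply Complex.ofReal_injective
  push_cast
  have hsq : ∀ x : H, ((‖x‖ : ℂ)) ^ 2 = inner ℂ x x := fun x =>
    (inner_self_eq_norm_sq_to_K (𝕜 := ℂ) x).symm
  simp only [hsq, sum_inner, inner_sum, inner_smul_left, inner_smul_right, Complex.conj_ofReal,
    Finset.mul_sum]
  rw [Finset.sum_comm]
  refine Finset.sum_congr rfl fun w _ => ?_
  rw [Finset.sum_comm]
  have key : ∀ w', ∑ g, (v g : ℂ) * ((K g w : ℂ) * ((K g w' : ℂ) * inner ℂ (χ w') (χ w))) =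
      if w = w' then (c : ℂ) * inner ℂ (χ w') (χ w) else 0 := by
    intro w'
    have h' := congrArg (fun t : ℝ => (t : ℂ)) (h w w')
    simp only [Complex.ofReal_sum, Complex.ofReal_mul] at h'
    simp only [← mul_assoc, ← Finset.sum_mul] at h' ⊢
    rw [h']
    split_ifs <;> simp
  refine Eq.trans (Finset.sum_congr rfl fun w' _ =>
    Eq.trans (Finset.sum_congr rfl fun g _ => ?_) (key w')) (by simp)
  ring

/-- The probability that two photons of an `n`-photon pulse reach the arm `c` and the other arm. -/
lemma PassiveReceiver.sum_arm_ne_arm (B : PassiveReceiver) {n : ℕ} {l₀ l₁ : Fin n} (hl : l₀ ≠ l₁)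
    (c : Arm) (w w' : Fin n → Fin 2) :
    ∑ g : Fin n → Detector,
      ((if (g l₀).1 = c then 1 else 0) * (if (g l₁).1 = c then 0 else 1)) *
        ((∏ l, B.amplitude (g l) (w l)) * ∏ l, B.amplitude (g l) (w' l)) =
      (B.armProb c * (1 - B.armProb c)) * if w = w' then 1 else 0 := by
  -- The arm constraints are written as a product over photons, so that the sum over configurations
  -- factorizes; photons other than `l₀`, `l₁` carry weight 1.
  set U : Fin n → Detector → ℝ := fun l j =>
    (if l = l₀ then (if j.1 = c then 1 else 0) else 1) *
      (if l = l₁ then (if j.1 = c then 0 else 1) else 1) with hU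
  have h := Finset.prod_univ_sum (fun _ : Fin n => (Finset.univ : Finset Detector))
    (fun l j => U l j * (B.amplitude j (w l) * B.amplitude j (w' l)))
  rw [Fintype.piFinset_univ] at h
  have hsum : ∀ l, ∑ j, U l j * (B.amplitude j (w l) * B.amplitude j (w' l)) =
      ((if l = l₀ then B.armProb c else 1) * (if l = l₁ then 1 - B.armProb c else 1)) *
        if w l = w' l then 1 else 0 := by
    intro l
    by_cases h0 : l = l₀
    · have h1 : l ≠ l₁ := h0 ▸ hl
      simp only [hU, h0, if_true, if_neg (h0 ▸ h1), mul_one]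
      exact B.sum_amplitude_arm c _ _
    · by_cases h1 : l = l₁
      · have h2 : ∀ j : Detector, (if j.1 = c then (0 : ℝ) else 1) =
            1 - if j.1 = c then 1 else 0 := fun j => by split_ifs <;> simp
        simp only [hU, if_neg h0, if_pos h1, h2, one_mul, sub_mul, Finset.sum_sub_distrib,
          B.sum_amplitude_arm, B.sum_amplitude]
      · simp only [hU, if_neg h0, if_neg h1, one_mul, B.sum_amplitude]
  simp only [hsum, Finset.prod_mul_distrib, Finset.prod_ite_eq', Finset.mem_univ, if_true] at h
  have hδ : (∏ l, if w l = w' l then (1 : ℝ) else 0) = if w = w' then 1 else 0 := by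
    rw [Finset.prod_ite_zero]
    simp [funext_iff]
  rw [hδ] at h
  rw [h]
  refine Finset.sum_congr rfl fun g _ => ?_
  simp only [hU, Finset.prod_mul_distrib, Finset.prod_ite_eq', Finset.mem_univ, if_true]

/-- In each sector with at least two photons, the multi-click probability is at least `λ_min`. -/
lemma PassiveReceiver.lambdaMin_mul_sum_le (B : PassiveReceiver) {n : ℕ} (hn : 1 < n)
    (χ : PhotonWord (Fin 2) → H) :
    B.lambdaMin * ∑ w : Fin n → Fin 2, ‖χ ⟨n, w⟩‖ ^ 2 ≤
      ∑ g : Fin n → Detector, B.multiClick ⟨n, g⟩ * ‖B.wordAmp χ ⟨n, g⟩‖ ^ 2 := by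
  set l₀ : Fin n := ⟨0, by omega⟩
  set l₁ : Fin n := ⟨1, hn⟩
  have hl : l₀ ≠ l₁ := by simp [l₀, l₁]
  have h := fun c => sum_mul_norm_sq_eq _ _ _ (B.sum_arm_ne_arm hl c) fun w => χ ⟨n, w⟩
  have hlam : B.lambdaMin * ∑ w : Fin n → Fin 2, ‖χ ⟨n, w⟩‖ ^ 2 = B.eta ^ 2 *
      (B.armProb Arm.X * (1 - B.armProb Arm.X) * ∑ w : Fin n → Fin 2, ‖χ ⟨n, w⟩‖ ^ 2 +
       B.armProb Arm.Z * (1 - B.armProb Arm.Z) * ∑ w : Fin n → Fin 2, ‖χ ⟨n, w⟩‖ ^ 2) := by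
    simp only [PassiveReceiver.lambdaMin, PassiveReceiver.armProb]
    ring
  rw [hlam, ← h, ← h, ← Finset.sum_add_distrib, Finset.mul_sum]
  -- For each `g` the indicators for the two arms add up to 1 if the two photons are in different
  -- arms, and to 0 otherwise.
  refine Finset.sum_le_sum fun g _ => ?_
  rw [← add_mul, ← mul_assoc]
  refine mul_le_mul_of_nonneg_right ?_ (by positivity)
  have hm := B.multiClick_nonneg ⟨n, g⟩
  by_cases hg : (g l₀).1 = (g l₁).1
  · rw [hg]
    split_ifs <;> simpa using hm
  · have hgg := B.sq_eta_le_multiClick ⟨n, g⟩ (l₀ := l₀) (l₁ := l₁)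
      fun h' => hg (congrArg Prod.fst h')
    cases h0 : (g l₀).1 <;> cases h1 : (g l₁).1 <;> simp_all

lemma PassiveReceiver.lambdaMin_mem (B : PassiveReceiver) :
    B.lambdaMin ∈ Set.Ioc (0 : ℝ) 1 := by
  obtain ⟨h0, h1⟩ := B.s_mem
  obtain ⟨h2, h3⟩ := B.eta_mem
  have h4 : 0 < 1 - B.s := by linarith
  refine ⟨by unfold PassiveReceiver.lambdaMin; positivity, ?_⟩
  exact mul_le_one₀ (pow_le_one₀ h2.le h3) (by positivity) (by nlinarith [sq_nonneg (B.s - 1 / 2)])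

lemma PassiveReceiver.isMultiClickLowerBound_lambdaMin (B : PassiveReceiver) :
    B.IsMultiClickLowerBound B.lambdaMin := by
  intro φ hφ
  rw [B.prob_multiClick φ hφ]
  set χ : PhotonWord (Fin 2) → ℂ := fun u => φ.coeff fun _ => u with hχ
  have hnorm : ∑' u, ‖χ u‖ₑ ^ 2 = 1 := by
    rw [← φ.norm_eq_one, ← (Equiv.funUnique (Fin 1) (PhotonWord (Fin 2))).symm.tsum_eq]
    rfl
  -- The optics preserves the photon number, so both sides split over the sectors without cross
  -- terms.
  rw [← mul_one (ENNReal.ofReal B.lambdaMin), ← hnorm, ENNReal.tsum_sigma', ENNReal.tsum_sigma',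
    ← ENNReal.tsum_mul_left]
  refine ENNReal.tsum_le_tsum fun n => ?_
  rw [tsum_fintype, tsum_fintype]
  rcases lt_or_ge 1 n with hn | hn
  · simp only [enorm_sq_eq_ofReal]
    rw [← ENNReal.ofReal_sum_of_nonneg (fun _ _ => by positivity),
      ← ENNReal.ofReal_mul B.lambdaMin_mem.1.le]
    refine (ENNReal.ofReal_le_ofReal (B.lambdaMin_mul_sum_le hn χ)).trans_eq ?_
    rw [ENNReal.ofReal_sum_of_nonneg
      (fun _ _ => mul_nonneg (B.multiClick_nonneg _) (by positivity))]
    exact Finset.sum_congr rfl fun g _ => ENNReal.ofReal_mul (B.multiClick_nonneg _)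
  · have h0 : ∀ w : Fin n → Fin 2, χ ⟨n, w⟩ = 0 := by
      intro w
      by_contra h
      exact absurd (hφ _ h) (not_lt.2 hn)
    simp [h0]

/-! ### From normalized scalar pulses to pulses entangled with another system. -/

lemma PassiveReceiver.wordAmp_smul (B : PassiveReceiver) (c : ℂ) (f : PhotonWord (Fin 2) → ℂ)
    (x : PhotonWord Detector) : B.wordAmp (fun u => c * f u) x = c * B.wordAmp f x := by
  unfold PassiveReceiver.wordAmp
  rw [Finset.mul_sum]
  exact Finset.sum_congr rfl fun w _ => by simp only [smul_eq_mul]; ring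

lemma PassiveReceiver.wordAmp_inner (B : PassiveReceiver) (b : H) (χ : PhotonWord (Fin 2) → H)
    (x : PhotonWord Detector) :
    B.wordAmp (fun u => inner ℂ b (χ u)) x = inner ℂ b (B.wordAmp χ x) := by
  simp [PassiveReceiver.wordAmp]

/-- A lower bound on the multi-click probability holds for unnormalized pulses. -/
lemma PassiveReceiver.IsMultiClickLowerBound.ofReal_mul_tsum_le {B : PassiveReceiver} {lam : ℝ}
    (h : B.IsMultiClickLowerBound lam) (f : PhotonWord (Fin 2) → ℂ)
    (hsupp : ∀ u, f u ≠ 0 → 1 < u.1)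
    (hbos : ∀ (u : PhotonWord (Fin 2)) (π : Equiv.Perm (Fin u.1)), f ⟨u.1, u.2 ∘ π⟩ = f u)
    (hfin : ∑' u, ‖f u‖ₑ ^ 2 ≠ ∞) :
    ENNReal.ofReal lam * ∑' u, ‖f u‖ₑ ^ 2 ≤
      ∑' x, ENNReal.ofReal (B.multiClick x) * ‖B.wordAmp f x‖ₑ ^ 2 := by
  set S := ∑' u, ‖f u‖ₑ ^ 2 with hS
  rcases eq_or_ne S 0 with h0 | h0
  · simp [h0]
  have hpos : 0 < S.toReal := ENNReal.toReal_pos h0 hfin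
  -- The factor that normalizes `f`; both sides of the bound scale by its squared norm `S⁻¹`.
  set c : ℂ := (((√S.toReal)⁻¹ : ℝ) : ℂ) with hc
  have hcS : ‖c‖ₑ ^ 2 = S⁻¹ := by
    rw [enorm_sq_eq_ofReal, hc, Complex.norm_real, Real.norm_eq_abs, sq_abs, inv_pow,
      Real.sq_sqrt hpos.le, ENNReal.ofReal_inv_of_pos hpos, ENNReal.ofReal_toReal hfin]
  let φ : PulseTrainState 1 ℂ :=
    { coeff := fun w => c * f (w 0)
      norm_eq_one := by
        rw [← (Equiv.funUnique (Fin 1) (PhotonWord (Fin 2))).symm.tsum_eq]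
        simp only [enorm_mul, mul_pow, ENNReal.tsum_mul_left, hcS]
        exact ENNReal.inv_mul_cancel h0 hfin
      bosonic := fun w r π => by
        obtain rfl : r = 0 := Subsingleton.elim _ _
        rw [Function.update_self, hbos] }
  have hφ := h φ fun w hw => hsupp _ (right_ne_zero_of_mul hw)
  rw [B.prob_multiClick φ fun w hw => hsupp _ (right_ne_zero_of_mul hw)] at hφ
  have hamp : ∀ x, B.wordAmp (fun u => φ.coeff fun _ => u) x = c * B.wordAmp f x :=
    fun x => B.wordAmp_smul c f x
  simp only [hamp, enorm_mul, mul_pow, hcS, mul_left_comm _ S⁻¹, ENNReal.tsum_mul_left] at hφ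
  calc ENNReal.ofReal lam * S ≤ S⁻¹ * _ * S := mul_le_mul_left hφ S
    _ = _ := by rw [mul_right_comm, ENNReal.inv_mul_cancel h0 hfin, one_mul]

/-- Parseval's identity in extended nonnegative form, where sums over the basis and over
configurations commute freely. -/
lemma enorm_sq_eq_tsum_inner {ι : Type*} (b : HilbertBasis ι ℂ H) (x : H) :
    ‖x‖ₑ ^ 2 = ∑' i, ‖(inner ℂ (b i) x : ℂ)‖ₑ ^ 2 := by
  have hn : ∀ i, (inner ℂ x (b i) * inner ℂ (b i) x : ℂ) =
      ((‖(inner ℂ (b i) x : ℂ)‖ ^ 2 : ℝ) : ℂ) := by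
    intro i
    rw [← inner_conj_symm, mul_comm, Complex.mul_conj, Complex.normSq_eq_norm_sq]
  have h := b.hasSum_inner_mul_inner x x
  simp only [hn, inner_self_eq_norm_sq_to_K] at h
  have h' : HasSum (fun i => ‖(inner ℂ (b i) x : ℂ)‖ ^ 2) (‖x‖ ^ 2) := by
    refine Complex.hasSum_ofReal.1 ?_
    rw [Complex.ofReal_pow ‖x‖]
    exact h
  simp only [enorm_sq_eq_ofReal]
  rw [← h'.tsum_eq, ENNReal.ofReal_tsum_of_nonneg (fun _ => by positivity) h'.summable]

/-- A lower bound on the multi-click probability holds for a pulse which is entangled with another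
system. -/
lemma PassiveReceiver.IsMultiClickLowerBound.ofReal_mul_tsum_le_of_completeSpace
    [CompleteSpace H] {B : PassiveReceiver} {lam : ℝ}
    (h : B.IsMultiClickLowerBound lam) (χ : PhotonWord (Fin 2) → H)
    (hsupp : ∀ u, χ u ≠ 0 → 1 < u.1)
    (hbos : ∀ (u : PhotonWord (Fin 2)) (π : Equiv.Perm (Fin u.1)), χ ⟨u.1, u.2 ∘ π⟩ = χ u)
    (hfin : ∑' u, ‖χ u‖ₑ ^ 2 ≠ ∞) :
    ENNReal.ofReal lam * ∑' u, ‖χ u‖ₑ ^ 2 ≤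
      ∑' x, ENNReal.ofReal (B.multiClick x) * ‖B.wordAmp χ x‖ₑ ^ 2 := by
  obtain ⟨_, b, _⟩ := exists_hilbertBasis ℂ H
  have hS : ∑' u, ‖χ u‖ₑ ^ 2 = ∑' i, ∑' u, ‖(inner ℂ (b i) (χ u) : ℂ)‖ₑ ^ 2 := by
    rw [ENNReal.tsum_comm]
    exact tsum_congr fun u => enorm_sq_eq_tsum_inner b _
  have hR : ∑' x, ENNReal.ofReal (B.multiClick x) * ‖B.wordAmp χ x‖ₑ ^ 2 =
      ∑' i, ∑' x, ENNReal.ofReal (B.multiClick x) *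
        ‖B.wordAmp (fun u => inner ℂ (b i) (χ u)) x‖ₑ ^ 2 := by
    rw [ENNReal.tsum_comm]
    refine tsum_congr fun x => ?_
    simp only [B.wordAmp_inner]
    rw [ENNReal.tsum_mul_left, enorm_sq_eq_tsum_inner b]
  rw [hR, hS, ← ENNReal.tsum_mul_left]
  refine ENNReal.tsum_le_tsum fun i => h.ofReal_mul_tsum_le _ (fun u hu => hsupp u ?_)
    (fun u π => by rw [hbos]) ?_
  · rintro h0
    simp [h0] at hu
  · refine ne_top_of_le_ne_top hfin ?_
    rw [hS]
    exact ENNReal.le_tsum i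

/-! ### Isolating one round. -/

/-- The vector of the pulse in round `r` and of the further system when the photons of the other
rounds are in the configuration `y` at the detector inputs. -/
def PassiveReceiver.roundVector (B : PassiveReceiver) {N : ℕ}
    (φ : (Fin N → PhotonWord (Fin 2)) → H) (r : Fin N)
    (y : {j : Fin N // j ≠ r} → PhotonWord Detector) (u : PhotonWord (Fin 2)) : H :=
  ∑ w : (j : {j : Fin N // j ≠ r}) → Fin (y j).1 → Fin 2,
    ((∏ j, ∏ l, B.amplitude ((y j).2 l) (w j l) : ℝ) : ℂ) •
      φ fun j => if h : j = r then u else ⟨(y ⟨j, h⟩).1, w ⟨j, h⟩⟩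

/-- The amplitude is a product over rounds, so the sum over the words of the other rounds can be
carried out first. -/
lemma PassiveReceiver.detectorAmp_eq_wordAmp (B : PassiveReceiver) {N : ℕ}
    (φ : (Fin N → PhotonWord (Fin 2)) → H) (r : Fin N) (g : Fin N → PhotonWord Detector) :
    B.detectorAmp φ g = B.wordAmp (B.roundVector φ r fun j => g j) (g r) := by
  unfold PassiveReceiver.detectorAmp PassiveReceiver.wordAmp PassiveReceiver.roundVector
  simp only [Finset.smul_sum]
  rw [← Fintype.sum_prod_type', ← (Equiv.piSplitAt r fun j => Fin (g j).1 → Fin 2).sum_comp]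
  refine Finset.sum_congr rfl fun w _ => ?_
  rw [smul_smul, ← Complex.ofReal_mul]
  congr 2
  · exact Fintype.prod_eq_mul_prod_subtype_ne (fun j => ∏ l, B.amplitude ((g j).2 l) (w j l)) r
  · funext j
    split_ifs with hj
    · subst hj; rfl
    · rfl

lemma PassiveReceiver.roundVector_bosonic (B : PassiveReceiver) {N : ℕ}
    {φ : (Fin N → PhotonWord (Fin 2)) → H} (r : Fin N)
    (hφ : ∀ (w : Fin N → PhotonWord (Fin 2)) (π : Equiv.Perm (Fin (w r).1)),
      φ (Function.update w r ⟨(w r).1, (w r).2 ∘ π⟩) = φ w)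
    (y : {j : Fin N // j ≠ r} → PhotonWord Detector) (u : PhotonWord (Fin 2))
    (π : Equiv.Perm (Fin u.1)) :
    B.roundVector φ r y ⟨u.1, u.2 ∘ π⟩ = B.roundVector φ r y u := by
  unfold PassiveReceiver.roundVector
  refine Finset.sum_congr rfl fun w _ => congrArg _ ?_
  set v : Fin N → PhotonWord (Fin 2) :=
    fun j => if h : j = r then u else ⟨(y ⟨j, h⟩).1, w ⟨j, h⟩⟩ with hv
  have hvr : v r = u := by simp [hv]
  -- The type of `π` depends on the word; a free `u'` allows substitution along `v r = u'`.
  have key : ∀ (u' : PhotonWord (Fin 2)) (π : Equiv.Perm (Fin u'.1)), v r = u' →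
      φ (Function.update v r ⟨u'.1, u'.2 ∘ π⟩) = φ v := by
    rintro _ π rfl
    exact hφ v π
  rw [← key u π hvr]
  congr 1
  funext j
  by_cases hj : j = r
  · subst hj; simp
  · simp [hj, hv]

lemma PassiveReceiver.roundVector_eq_zero (B : PassiveReceiver) {N : ℕ}
    {φ : (Fin N → PhotonWord (Fin 2)) → H} {r : Fin N} {u : PhotonWord (Fin 2)}
    (hφ : ∀ w : Fin N → PhotonWord (Fin 2), w r = u → φ w = 0)
    (y : {j : Fin N // j ≠ r} → PhotonWord Detector) : B.roundVector φ r y u = 0 :=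
  Finset.sum_eq_zero fun w _ => by rw [hφ _ (by simp), smul_zero]

lemma tsum_enorm_qndProject_le {N : ℕ} (ψ : PulseTrainState N H) (i : Fin N → QND) :
    ∑' w, ‖qndProject i ψ.coeff w‖ₑ ^ 2 ≤ 1 := by
  rw [← ψ.norm_eq_one]
  refine ENNReal.tsum_le_tsum fun w => ?_
  unfold qndProject
  split_ifs <;> simp

lemma qndProject_bosonic {N : ℕ} (ψ : PulseTrainState N H) (i : Fin N → QND)
    (w : Fin N → PhotonWord (Fin 2)) (r : Fin N) (π : Equiv.Perm (Fin (w r).1)) :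
    qndProject i ψ.coeff (Function.update w r ⟨(w r).1, (w r).2 ∘ π⟩) =
      qndProject i ψ.coeff w := by
  have hlen : ∀ j, (Function.update w r ⟨(w r).1, (w r).2 ∘ π⟩ j).1 = (w j).1 := by
    intro j
    by_cases hj : j = r
    · subst hj; simp
    · simp [hj]
  unfold qndProject
  simp only [hlen, ψ.bosonic]

/-- The weight of a click pattern with the pattern of the round `r` summed over, as a sum over the
photons in the other rounds. -/
lemma PassiveReceiver.sum_born_update (B : PassiveReceiver) {N : ℕ} (ψ : PulseTrainState N H)
    (i : Fin N → QND) (r : Fin N) (C : Fin N → Finset Detector) (P : Finset Detector → Prop)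
    [DecidablePred P] :
    (∑ c, if P c then B.born ψ (i, Function.update C r c) else 0) =
      ∑' y : {j : Fin N // j ≠ r} → PhotonWord Detector,
        ENNReal.ofReal (∏ j, B.response (y j) (C j)) *
          ∑' x, (∑ c, if P c then ENNReal.ofReal (B.response x c) else 0) *
            ‖B.wordAmp (B.roundVector (qndProject i ψ.coeff) r y) x‖ₑ ^ 2 := by
  have hborn : ∀ c, B.born ψ (i, Function.update C r c) =
      ∑' y : {j : Fin N // j ≠ r} → PhotonWord Detector, ∑' x,
        ENNReal.ofReal (∏ j, B.response (y j) (C j)) * (ENNReal.ofReal (B.response x c) *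
            ‖B.wordAmp (B.roundVector (qndProject i ψ.coeff) r y) x‖ₑ ^ 2) := by
    intro c
    unfold PassiveReceiver.born
    rw [ENNReal.tsum_comm, ← ENNReal.tsum_prod,
      ← (Equiv.funSplitAt r (PhotonWord Detector)).tsum_eq]
    refine tsum_congr fun g => ?_
    rw [B.detectorAmp_eq_wordAmp _ r, ← mul_assoc, ← ENNReal.ofReal_mul
      (Finset.prod_nonneg fun _ _ => B.response_nonneg _ _)]
    congr 2
    rw [Fintype.prod_eq_mul_prod_subtype_ne _ r, mul_comm]
    congr 1
    · refine Finset.prod_congr rfl fun j _ => ?_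
      change B.response (g j) (Function.update C r c j) = B.response (g j) (C j)
      rw [Function.update_of_ne j.2]
    · simp
  have hterm : ∀ c, (if P c then B.born ψ (i, Function.update C r c) else 0) =
      ∑' y : {j : Fin N // j ≠ r} → PhotonWord Detector,
        ENNReal.ofReal (∏ j, B.response (y j) (C j)) *
          ∑' x, (if P c then ENNReal.ofReal (B.response x c) else 0) *
            ‖B.wordAmp (B.roundVector (qndProject i ψ.coeff) r y) x‖ₑ ^ 2 := by
    intro c
    rw [hborn]
    split_ifs
    · simp only [ENNReal.tsum_mul_left]
    · simp
  rw [Finset.sum_congr rfl fun c _ => hterm c,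
    ← Summable.tsum_finsetSum (fun _ _ => ENNReal.summable)]
  refine tsum_congr fun y => ?_
  rw [← Finset.mul_sum, ← Summable.tsum_finsetSum (fun _ _ => ENNReal.summable)]
  simp only [Finset.sum_mul]

/-- In a round with more than one photon, `lam` bounds the multi-click probability from below given
the click patterns in all other rounds. -/
lemma PassiveReceiver.IsMultiClickLowerBound.ofReal_mul_sum_born_le [CompleteSpace H]
    {B : PassiveReceiver} {lam : ℝ} (h : B.IsMultiClickLowerBound lam) {N : ℕ}
    (ψ : PulseTrainState N H) {i : Fin N → QND} {r : Fin N} (hr : i r = QND.many)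
    (C : Fin N → Finset Detector) :
    ENNReal.ofReal lam * ∑ c, B.born ψ (i, Function.update C r c) ≤
      ∑ c : Finset Detector, if 2 ≤ c.card then B.born ψ (i, Function.update C r c) else 0 := by
  -- The trivial predicate gives the total weight: the responses of round `r` sum to 1, and by
  -- isometry only the squared norm of `roundVector` is left.
  have htot := B.sum_born_update ψ i r C fun _ => True
  simp only [if_true] at htot
  rw [htot, B.sum_born_update, ← ENNReal.tsum_mul_left]
  refine ENNReal.tsum_le_tsum fun y => ?_
  rw [mul_left_comm]
  refine mul_le_mul_right ?_ _
  simp only [← B.ofReal_multiClick]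
  have hone : ∀ x, ∑ c, ENNReal.ofReal (B.response x c) = 1 := fun x => by
    rw [← ENNReal.ofReal_sum_of_nonneg (fun c _ => B.response_nonneg x c), B.sum_response,
      ENNReal.ofReal_one]
  simp only [hone, one_mul]
  rw [B.tsum_enorm_wordAmp]
  refine h.ofReal_mul_tsum_le_of_completeSpace _ (fun u hu => ?_)
    (B.roundVector_bosonic r (fun w π => qndProject_bosonic ψ i w r π) y) ?_
  · by_contra hle
    refine hu (B.roundVector_eq_zero (fun w hw => if_neg fun hall => ?_) y)
    have := hall r
    rw [hr, hw] at this
    -- For these photon numbers `qndClass` is `zero` or `one`, against the outcome `many`.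
    obtain h0 | h0 : u.1 = 0 ∨ u.1 = 1 := by omega
    all_goals
      rw [h0] at this
      cases this
  · refine ne_top_of_le_ne_top ENNReal.one_ne_top (le_trans ?_ (tsum_enorm_qndProject_le ψ i))
    -- Finiteness: the squared norm for fixed `y` is a subsum of the total squared norm, which is at
    -- most 1.
    have hinj : Function.Injective fun x : PhotonWord Detector =>
        (Equiv.funSplitAt r (PhotonWord Detector)).symm (x, y) :=
      (Equiv.injective _).comp (Prod.mk_left_injective y)
    rw [← B.tsum_enorm_wordAmp, ← B.tsum_enorm_detectorAmp]
    refine le_trans (le_of_eq ?_) (ENNReal.tsum_comp_le_tsum_of_injective hinj _)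
    refine tsum_congr fun x => ?_
    rw [B.detectorAmp_eq_wordAmp _ r]
    have h1 := (Equiv.funSplitAt r (PhotonWord Detector)).apply_symm_apply (x, y)
    have h2 : (Equiv.funSplitAt r (PhotonWord Detector)).symm (x, y) r = x :=
      congrArg Prod.fst h1
    have h3 : (fun j : {j : Fin N // j ≠ r} =>
      (Equiv.funSplitAt r (PhotonWord Detector)).symm (x, y) j) = y := congrArg Prod.snd h1
    rw [h2, h3]

/-! ### The tail bound for the whole run. -/

/-- Given the photon-number classes, the number of multi-clicks stochastically dominates a binomial
law. -/
lemma PassiveReceiver.IsMultiClickLowerBound.sum_born_le [CompleteSpace H]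
    {B : PassiveReceiver} {lam : ℝ} (h : B.IsMultiClickLowerBound lam)
    (hlam : lam ∈ Set.Ioc (0 : ℝ) 1) {N : ℕ} (ψ : PulseTrainState N H) (i : Fin N → QND) (k : ℕ) :
    (∑ C : Fin N → Finset Detector,
      if numMultiClick ((i, C) : Record N) ≤ k then B.born ψ (i, C) else 0) ≤
      ENNReal.ofReal (binomCDF (Finset.univ.filter fun r => i r = QND.many).card lam k) *
        ∑ C, B.born ψ (i, C) := by
  have hne : ∀ x, B.born ψ x ≠ ∞ := fun x => (B.recordLaw ψ).apply_ne_top x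
  have hq := sum_count_le_binomCDF (fun C => (B.born ψ (i, C)).toReal)
    (fun c : Finset Detector => 2 ≤ c.card) hlam.1.le hlam.2
    (Finset.univ.filter fun r => i r = QND.many) (fun r hr C => ?_) k
  · have hsum : ∀ Q : (Fin N → Finset Detector) → Prop, ∀ _ : DecidablePred Q,
        (∑ C, if Q C then B.born ψ (i, C) else 0) =
        ENNReal.ofReal (∑ C, if Q C then (B.born ψ (i, C)).toReal else 0) := by
      intro Q _
      rw [ENNReal.ofReal_sum_of_nonneg fun C _ => by split_ifs <;> simp]
      exact Finset.sum_congr rfl fun C _ => by split_ifs <;> simp [hne]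
    have htot := hsum (fun _ => True) inferInstance
    simp only [if_true] at htot
    rw [htot, ← ENNReal.ofReal_mul (binomCDF_nonneg hlam.1.le hlam.2 _ _)]
    refine le_trans ?_ (ENNReal.ofReal_le_ofReal hq)
    rw [← hsum]
    refine Finset.sum_le_sum fun C _ => ?_
    split_ifs with h1 h2
    · exact le_rfl
    -- Multi-clicks outside the multi-photon rounds only increase the observed count.
    · refine absurd (le_trans (Finset.card_le_card ?_) h1) h2
      exact Finset.filter_subset_filter _ (Finset.subset_univ _)
    · exact zero_le
    · exact le_rfl
  · have hr' := ENNReal.toReal_mono (ENNReal.sum_ne_top.2 fun c _ => by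
        split_ifs <;> simp [hne]) (h.ofReal_mul_sum_born_le ψ (Finset.mem_filter.1 hr).2 C)
    rw [ENNReal.toReal_mul, ENNReal.toReal_ofReal hlam.1.le,
      ENNReal.toReal_sum fun c _ => hne _, ENNReal.toReal_sum fun c _ => by
        split_ifs <;> simp [hne]] at hr'
    refine hr'.trans_eq (Finset.sum_congr rfl fun c _ => ?_)
    split_ifs <;> simp

/-- The exact tail bound for the number of rounds with more than one photon. -/
lemma PassiveReceiver.IsMultiClickLowerBound.prob_Vex_le [CompleteSpace H]
    {B : PassiveReceiver} {lam : ℝ} (h : B.IsMultiClickLowerBound lam)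
    (hlam : lam ∈ Set.Ioc (0 : ℝ) 1) {N : ℕ} (ψ : PulseTrainState N H) (ε : ℝ) :
    B.prob ψ {x | Vex N (numMultiClick x) ε lam ≤ numMany x} ≤ ENNReal.ofReal ε := by
  classical
  rw [B.prob_eq_sum]
  calc _ ≤ ∑ i, ENNReal.ofReal ε * ∑ C, B.born ψ (i, C) := Finset.sum_le_sum fun i _ => ?_
    _ = ENNReal.ofReal ε := by
      rw [← Finset.mul_sum, ← Fintype.sum_prod_type, B.sum_born, mul_one]
  set t := (Finset.univ.filter fun r => i r = QND.many).card with ht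
  have htN : t ≤ N := (Finset.card_le_univ _).trans_eq (Fintype.card_fin N)
  -- The counts `k` that are bad for this `t`. Covering them by {count ≤ max `K`} avoids any
  -- monotonicity of `Vex` in `k`.
  set K := (Finset.range (t + 1)).filter fun k => Vex N k ε lam ≤ t with hK
  have hmem : ∀ C : Fin N → Finset Detector,
      (i, C) ∈ {x : Record N | Vex N (numMultiClick x) ε lam ≤ numMany x} →
      numMultiClick ((i, C) : Record N) ∈ K := fun C hC =>
    Finset.mem_filter.2 ⟨Finset.mem_range.2 (Nat.lt_succ_of_le (le_of_Vex_le htN hC)), hC⟩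
  rcases K.eq_empty_or_nonempty with hempty | hne
  · refine (Finset.sum_eq_zero fun C _ => if_neg fun hC => ?_).trans_le zero_le
    have := hmem C hC
    simp [hempty] at this
  · have hmax := (Finset.mem_filter.1 (K.max'_mem hne)).2
    calc _ ≤ ∑ C : Fin N → Finset Detector,
          if numMultiClick ((i, C) : Record N) ≤ K.max' hne then B.born ψ (i, C) else 0 := ?_
      _ ≤ _ := h.sum_born_le hlam ψ i _
      _ ≤ _ := mul_le_mul_left
        (ENNReal.ofReal_le_ofReal (binomCDF_le_of_Vex_le hlam.1.le hlam.2 htN hmax)) _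
    refine Finset.sum_le_sum fun C _ => ?_
    split_ifs with h1 h2
    · exact le_rfl
    · exact absurd (K.le_max' _ (hmem C h1)) h2
    · exact zero_le
    · exact le_rfl

end PassiveBB84
end

theorem mainTheorem1 (B : PassiveBB84.PassiveReceiver) (N : ℕ)
    {H : Type*} [NormedAddCommGroup H] [InnerProductSpace ℂ H] [CompleteSpace H]
    (ψ : PassiveBB84.PulseTrainState N H) (ε : ℝ) (hε : 0 ≤ ε) :
    (B.lambdaMin ∈ Set.Ioc (0 : ℝ) 1 ∧ B.IsMultiClickLowerBound B.lambdaMin) ∧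
    B.prob ψ {x | PassiveBB84.Vex N (PassiveBB84.numMultiClick x) ε B.lambdaMin ≤
        PassiveBB84.numMany x} ≤ ENNReal.ofReal ε ∧
    ∀ lam ∈ Set.Ioc (0 : ℝ) 1, B.IsMultiClickLowerBound lam →
      B.prob ψ {x | PassiveBB84.Vex N (PassiveBB84.numMultiClick x) ε lam ≤
        PassiveBB84.numMany x} ≤ ENNReal.ofReal ε :=
  ⟨⟨B.lambdaMin_mem, B.isMultiClickLowerBound_lambdaMin⟩,
    B.isMultiClickLowerBound_lambdaMin.prob_Vex_le B.lambdaMin_mem ψ ε,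
    fun _ hlam h => h.prob_Vex_le hlam ψ ε⟩
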